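/- Let $q=2^r$ with $r\ge 1$, and let $\mathbb{G}_q=\mathbb{Z}_4[X]/(h)$ be the Galois ring of order $q^2$ and characteristic $4$, where $h\in\mathbb{Z}_4[X]$ is any monic polynomial of degree $r$ that is irreducible modulo $2$. Let $\Pi=\mathrm{PHG}(2,\mathbb{G}_q)$ be the incidence structure whose points and lines are the free submodules of $\mathbb{G}_q^3$ of rank $1$ and rank $2$, respectively, with inclusion as incidence, and let $\Pi^*$ be its dual (points and lines interchanged, incidence reversed). A multiset $\mathcal{K}$ of points of $\Pi$ assigns to each point a multiplicity in $\mathbb{N}_0$; the multiplicity $\mathcal{K}(L)$ of a line $L$ is the sum of the multiplicities of the points on $L$. A $(k,n)$-arc is a multiset of points of total multiplicity $k$ with $\mathcal{K}(L)\le n$ for every line $L$. It is projective if it is a set (all multiplicities are $0$ or $1$), and maximal if $k'\le k$ for every $(k',n)$-arc, projective or not. Let $\mathrm{m}_n(\mathbb{G}_q)$ be the largest $k$ for which $\Pi$ has a projective $(k,n)$-arc. A hyperoval is a $(q^2+q+1,2)$-arc, and its passants are the lines of multiplicity $0$. Then $\Pi$ has hyperovals, and $\Pi^*\cong\Pi$.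 For every hyperoval $\mathcal{H}$ of $\Pi$ and every isomorphism $\sigma\colon\Pi^*\to\Pi$, the set of the passants of $\mathcal{H}$, regarded as points of $\Pi^*$ and mapped to $\Pi$ by $\sigma$, is a projective $\bigl((q^4-q)/2,\,q^2/2\bigr)$-arc in $\Pi$ that meets every line of $\Pi$ in either $0$ or $q^2/2$ points, and this arc is maximal. In particular such arcs exist, and $$\mathrm{m}_{q^2/2}(\mathbb{G}_q)=\frac{q^4-q}{2}.$$ -/

import Mathlib

open Polynomial

/-- A point-line incidence structure. -/
structure IncidenceStructure where
  Point : Type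
  Line : Type
  incident : Point → Line → Prop

namespace IncidenceStructure

/-- The dual incidence structure: points and lines are interchanged, incidence is reversed. -/
def dual (S : IncidenceStructure) : IncidenceStructure where
  Point := S.Line
  Line := S.Point
  incident L x := S.incident x L

/-- Isomorphisms of incidence structures. -/
structure Iso (S T : IncidenceStructure) where
  onPoints : S.Point ≃ T.Point
  onLines : S.Line ≃ T.Line
  incident_iff : ∀ (x : S.Point) (L : S.Line),
    T.incident (onPoints x) (onLines L) ↔ S.incident x L

variable {S T : IncidenceStructure}

/-- Size of a multiset of points, given by its multiplicity function. It is only used for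
incidence structures with finitely many points, where the sum is an ordinary finite sum. -/
noncomputable def size (K : S.Point → ℕ) : ℕ := ∑ᶠ x, K x

/-- Multiplicity `K(L)` of a line: the sum of the multiplicities of its points. -/
noncomputable def lineMult (K : S.Point → ℕ) (L : S.Line) : ℕ :=
  ∑ᶠ (x) (_ : S.incident x L), K x

/-- A multiset of points is projective if it is a set, i.e. all multiplicities are `0` or `1`. -/
def IsProjective (K : S.Point → ℕ) : Prop := ∀ x, K x = 0 ∨ K x = 1

/-- `(k, n)`-arcs (multisets; not necessarily projective). -/
def IsArc (K : S.Point → ℕ) (k n : ℕ) : Prop := size K = k ∧ ∀ L, lineMult K L ≤ n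

/-- Maximal `(k, n)`-arcs: `k' ≤ k` for all `(k', n)`-arcs, projective or not. -/
def IsMaximalArc (K : S.Point → ℕ) (k n : ℕ) : Prop :=
  IsArc K k n ∧ ∀ (k' : ℕ) (K' : S.Point → ℕ), IsArc K' k' n → k' ≤ k

/-- The largest size of a projective arc with at most `n` points on every line. -/
noncomputable def maxArcSize (S : IncidenceStructure) (n : ℕ) : ℕ :=
  sSup {k : ℕ | ∃ K : S.Point → ℕ, IsProjective K ∧ IsArc K k n}

/-- A passant of a multiset of points is a line of multiplicity `0`. -/
def IsPassant (K : S.Point → ℕ) (L : S.Line) : Prop := lineMult K L = 0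

open Classical in
/-- The set of passants of `K`, as a (projective) multiset of points of the dual structure. -/
noncomputable def passants (K : S.Point → ℕ) : S.dual.Point → ℕ :=
  fun L : S.Line => if IsPassant K L then 1 else 0

/-- The image of a multiset of points under an isomorphism. -/
def Iso.mapMultiset (σ : Iso S T) (K : S.Point → ℕ) : T.Point → ℕ :=
  fun x => K (σ.onPoints.symm x)

end IncidenceStructure

/-- The projective Hjelmslev plane `PHG(2, R)` over a commutative (chain) ring `R`, for which left
and right modules agree: the points (lines) are the free submodules of `R ^ 3` of rank `1`
(rank `2`), and incidence is inclusion. -/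
def PHG (R : Type) [CommRing R] : IncidenceStructure where
  Point := {N : Submodule R (Fin 3 → R) // Module.Free R N ∧ Module.finrank R N = 1}
  Line := {N : Submodule R (Fin 3 → R) // Module.Free R N ∧ Module.finrank R N = 2}
  incident x L := x.1 ≤ L.1

theorem PHG.finite_point (R : Type) [CommRing R] [Finite R] : Finite (PHG R).Point :=
  inferInstanceAs (Finite {_N : Submodule R (Fin 3 → R) // _})

/-- Polynomials `h` defining the Galois ring of characteristic `p ^ 2` and order `p ^ (2 * r)`:
`h` is monic of degree `r` over `ℤ / p ^ 2` and irreducible modulo `p`. -/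
structure IsGaloisPoly (p r : ℕ) (h : (ZMod (p ^ 2))[X]) : Prop where
  monic : h.Monic
  natDegree_eq : h.natDegree = r
  irreducible : Irreducible (h.map (ZMod.castHom (dvd_pow_self p two_ne_zero) (ZMod p)))

/-- The Galois ring `(ℤ / p ^ 2)[X] / (h)`. -/
abbrev GaloisRing (p : ℕ) (h : (ZMod (p ^ 2))[X]) : Type := AdjoinRoot h

theorem IsGaloisPoly.finite {p r : ℕ} [NeZero p] {h : (ZMod (p ^ 2))[X]}
    (hh : IsGaloisPoly p r h) : Finite (GaloisRing p h) := by
  have : NeZero (p ^ 2) := ⟨pow_ne_zero 2 (NeZero.ne p)⟩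
  have : Module.Finite (ZMod (p ^ 2)) (AdjoinRoot h) := hh.monic.finite_adjoinRoot
  exact Module.finite_of_finite (ZMod (p ^ 2))

open IncidenceStructure in
/-- Hyperovals of a projective Hjelmslev plane over a chain ring with `q ^ 2` elements. -/
def IsHyperoval {S : IncidenceStructure} (q : ℕ) (H : S.Point → ℕ) : Prop :=
  IsArc H (q ^ 2 + q + 1) 2

/-! Everything except the existence of hyperovals is double counting in `Π`, using the numbers of
lines through one or two points and the partition into `q^2 + q + 1` neighbour classes. If `u` is
the multiplicity of the class of `x` and `k` the size of `K`, the lines through `x` have total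
multiplicity `k + (q - 1)u + q^2 K(x)` (`sum_pencil`).

For a hyperoval and a point `x` in it, this is at least `2(q^2 + q)`, which is also an upper bound.
Equality gives one hyperoval point in each class and only lines of multiplicity `0` or `2`; hence
`q^2 / 2` passants through each point off the hyperoval, none through its points, and `(q^4 - q) /
2` in all. For the upper bound on an arc with `n = q^2 / 2`, the same identity is applied at a point
of a class of above-average multiplicity.

The polarity `N ↦ perp N` gives self-duality. A hyperoval comes from a cubic extension `S ≅ R^3` of
`R`: its points are spanned by squares of units, one for each point of the projective plane of the
residue field extension `K / k`. As `4 = 0`, a square depends only on the residue class of its root;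
three of these points on a line would give a nontrivial quadratic equation over `k` for an element
of `K` outside `k`, which is impossible in degree `3`. -/

namespace IncidenceStructure

/-- The counting properties of a projective Hjelmslev plane over a chain ring with `q ^ 2` elements
and residue field with `q` elements; `c` maps points to their neighbour classes. -/
structure HasHjelmslevCounts (S : IncidenceStructure) (q : ℕ) {C : Type} (c : S.Point → C) :
    Prop where
  card_class : Nat.card C = q ^ 2 + q + 1
  card_line : Nat.card S.Line = q ^ 2 * (q ^ 2 + q + 1)
  card_pencil : ∀ x, Nat.card {L // S.incident x L} = q ^ 2 + q
  card_joint_of_eq : ∀ x y, x ≠ y → c x = c y →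
    Nat.card {L // S.incident x L ∧ S.incident y L} = q
  card_joint_of_ne : ∀ x y, c x ≠ c y → Nat.card {L // S.incident x L ∧ S.incident y L} = 1

/-! ### Double counting: hyperovals, passants and the upper bound -/

section Counting

variable {S : IncidenceStructure} {q : ℕ} {C : Type} {c : S.Point → C}

theorem size_eq_sum [Fintype S.Point] (K : S.Point → ℕ) : size K = ∑ x, K x :=
  finsum_eq_sum_of_fintype K

open Classical in
theorem lineMult_eq_sum [Fintype S.Point] (K : S.Point → ℕ) (L : S.Line) :
    lineMult K L = ∑ x, if S.incident x L then K x else 0 := by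
  rw [lineMult, finsum_eq_sum_of_fintype]
  exact Finset.sum_congr rfl fun x _ => finsum_eq_if

open Classical in
/-- The multiplicity of a neighbour class. -/
noncomputable def classMult [Fintype S.Point] (c : S.Point → C) (K : S.Point → ℕ) (a : C) : ℕ :=
  ∑ y, if c y = a then K y else 0

theorem sum_classMult [Fintype S.Point] [Fintype C] (c : S.Point → C) (K : S.Point → ℕ) :
    ∑ a, classMult c K a = size K := by
  classical
  rw [size_eq_sum]
  unfold classMult
  rw [Finset.sum_comm]
  exact Finset.sum_congr rfl fun y _ => by rw [Finset.sum_ite_eq, if_pos (Finset.mem_univ _)]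

theorem exists_of_classMult_ne_zero [Fintype S.Point] {K : S.Point → ℕ} {a : C}
    (h : classMult c K a ≠ 0) : ∃ x, c x = a ∧ K x ≠ 0 := by
  obtain ⟨x, -, hx⟩ := Finset.exists_ne_zero_of_sum_ne_zero h
  exact ⟨x, by simpa using hx⟩

theorem le_classMult [Fintype S.Point] (K : S.Point → ℕ) (x : S.Point) :
    K x ≤ classMult c K (c x) := by
  classical
  simpa [classMult] using Finset.single_le_sum (f := fun y => if c y = c x then K y else 0)
    (fun _ _ => Nat.zero_le _) (Finset.mem_univ x)

open Classical in
/-- The total multiplicity of the lines through a point. -/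
theorem HasHjelmslevCounts.sum_pencil [Fintype S.Point] [Fintype S.Line]
    (hS : S.HasHjelmslevCounts q c) (K : S.Point → ℕ) (x : S.Point) :
    (∑ L with S.incident x L, lineMult K L) + classMult c K (c x) =
      size K + q * classMult c K (c x) + q ^ 2 * K x := by
  -- Contribution of a single point `y`: it shares `q^2 + q`, `q` or `1` lines with `x`, according
  -- as `y = x`, `y` is another neighbour of `x`, or neither. The class term on the left replaces
  -- the subtraction in `q - 1`.
  have key : ∀ y, (∑ L with S.incident x L, if S.incident y L then K y else 0) +
      (if c y = c x then K y else 0) =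
      K y + q * (if c y = c x then K y else 0) + if y = x then q ^ 2 * K y else 0 := by
    intro y
    have h1 : (∑ L with S.incident x L, if S.incident y L then K y else 0) =
        Nat.card {L // S.incident x L ∧ S.incident y L} * K y := by
      rw [← Finset.sum_filter, Finset.sum_const, smul_eq_mul, Finset.filter_filter,
        Nat.card_eq_fintype_card, Fintype.card_subtype]
    rw [h1]
    by_cases hxy : y = x
    · subst hxy
      have := hS.card_pencil y
      simp only [and_self, this, if_true]
      ring
    · by_cases hc : c y = c x
      · rw [hS.card_joint_of_eq x y (Ne.symm hxy) hc.symm]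
        simp only [hc, if_true, hxy, if_false]
        ring
      · rw [hS.card_joint_of_ne x y (Ne.symm hc)]
        simp [hc, hxy]
  have h2 := Finset.sum_congr (s₁ := Finset.univ) rfl fun y _ => key y
  simp only [Finset.sum_add_distrib, ← Finset.mul_sum, Finset.sum_ite_eq', Finset.mem_univ,
    if_true] at h2
  rw [Finset.sum_comm] at h2
  simp only [lineMult_eq_sum, classMult, size_eq_sum]
  exact h2

open Classical in
theorem HasHjelmslevCounts.card_filter_incident [Fintype S.Line]
    (hS : S.HasHjelmslevCounts q c) (x : S.Point) :
    (Finset.univ.filter fun L => S.incident x L).card = q ^ 2 + q := by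
  rw [← hS.card_pencil x, Nat.card_eq_fintype_card, Fintype.card_subtype]

/-- With `u, K x ≥ 1` the pencil sum is at least `(q^2 + q + 1) + (q - 1) + q^2 = 2(q^2 + q)`, the
largest value allowed by `q^2 + q` lines of multiplicity at most `2`. So every inequality is an
equality. -/
theorem HasHjelmslevCounts.hyperoval_apply [Fintype S.Point] [Fintype S.Line]
    (hS : S.HasHjelmslevCounts q c) (hq : 2 ≤ q) {K : S.Point → ℕ} (hK : IsHyperoval q K)
    {x : S.Point} (hx : K x ≠ 0) :
    K x = 1 ∧ classMult c K (c x) = 1 ∧ ∀ L, S.incident x L → lineMult K L = 2 := by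
  classical
  obtain ⟨hk, hL⟩ := hK
  have h1 := hS.sum_pencil K x
  have h2 : (∑ L with S.incident x L, lineMult K L) ≤ ∑ L with S.incident x L, 2 :=
    Finset.sum_le_sum fun L _ => hL L
  have h3 : (∑ L with S.incident x L, 2) = (q ^ 2 + q) * 2 := by
    rw [Finset.sum_const, hS.card_filter_incident, smul_eq_mul]
  have h4 := le_classMult (c := c) K x
  rw [hk] at h1
  generalize classMult c K (c x) = u at *
  have hu : u = 1 := by
    have : 1 ≤ u := by lia
    have : 1 ≤ K x := by lia
    by_contra hne
    have : 2 ≤ u := by lia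
    nlinarith
  have hx1 : K x = 1 := by lia
  refine ⟨hx1, hu, ?_⟩
  have h5 : (∑ L with S.incident x L, lineMult K L) = ∑ L with S.incident x L, 2 := by
    rw [hu, hx1] at h1
    lia
  intro L hxL
  exact (Finset.sum_eq_sum_iff_of_le fun L _ => hL L).1 h5 L (by simpa using hxL)

theorem HasHjelmslevCounts.hyperoval_lineMult [Fintype S.Point] [Fintype S.Line]
    (hS : S.HasHjelmslevCounts q c) (hq : 2 ≤ q) {K : S.Point → ℕ} (hK : IsHyperoval q K)
    (L : S.Line) : lineMult K L = 0 ∨ lineMult K L = 2 := by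
  classical
  by_cases h : lineMult K L = 0
  · exact Or.inl h
  right
  rw [lineMult_eq_sum] at h
  obtain ⟨x, -, hx⟩ := Finset.exists_ne_zero_of_sum_ne_zero h
  have hx' : S.incident x L ∧ K x ≠ 0 := by simpa using hx
  exact (hS.hyperoval_apply hq hK hx'.2).2.2 L hx'.1

/-- A hyperoval meets every neighbour class in exactly one point. -/
theorem HasHjelmslevCounts.hyperoval_classMult [Fintype S.Point] [Fintype S.Line] [Fintype C]
    (hS : S.HasHjelmslevCounts q c) (hq : 2 ≤ q) {K : S.Point → ℕ} (hK : IsHyperoval q K)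
    (a : C) : classMult c K a = 1 := by
  have hle : ∀ a ∈ (Finset.univ : Finset C), classMult c K a ≤ 1 := by
    intro a _
    by_cases h : classMult c K a = 0
    · lia
    obtain ⟨x, rfl, hx⟩ := exists_of_classMult_ne_zero h
    exact (hS.hyperoval_apply hq hK hx).2.1.le
  have hsum : ∑ a, classMult c K a = ∑ _a : C, 1 := by
    rw [sum_classMult, hK.1, Finset.sum_const, Finset.card_univ, ← Nat.card_eq_fintype_card,
      hS.card_class]
    simp
  exact (Finset.sum_eq_sum_iff_of_le hle).1 hsum a (Finset.mem_univ a)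

/-- The sum of a function with values `0` and `2` is twice the number of its nonzero values. -/
theorem sum_add_two_mul_card_zeros {ι : Type} (s : Finset ι) {f : ι → ℕ}
    [DecidablePred fun i => f i = 0]
    (hf : ∀ i ∈ s, f i = 0 ∨ f i = 2) :
    ∑ i ∈ s, f i + 2 * (s.filter fun i => f i = 0).card = 2 * s.card := by
  rw [Finset.card_filter, Finset.mul_sum, ← Finset.sum_add_distrib, mul_comm, ← smul_eq_mul,
    ← Finset.sum_const]
  refine Finset.sum_congr rfl fun i hi => ?_
  rcases hf i hi with h | h <;> simp [h]

theorem lineMult_passants [Fintype S.Line] (K : S.Point → ℕ) (x : S.Point)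
    [DecidablePred fun L => S.incident x L] [DecidablePred fun L => lineMult K L = 0] :
    lineMult (S := S.dual) (passants K) x =
      ((Finset.univ.filter fun L => S.incident x L).filter fun L => lineMult K L = 0).card := by
  classical
  rw [Finset.filter_filter, Finset.card_filter]
  refine (@lineMult_eq_sum S.dual (inferInstanceAs (Fintype S.Line)) (passants K) x).trans ?_
  refine Finset.sum_congr rfl fun (L : S.Line) _ => ?_
  by_cases h1 : S.incident x L <;> by_cases h2 : lineMult K L = 0 <;>
    simp [dual, passants, IsPassant, h1, h2]

/-- Off the hyperoval the pencil sum is `q^2 + 2q`, all from lines of multiplicity `2`; the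
remaining lines of the pencil are passants, and twice their number is `2(q^2 + q) - (q^2 + 2q) =
q^2`. -/
theorem HasHjelmslevCounts.lineMult_passants_eq [Fintype S.Point] [Fintype S.Line] [Fintype C]
    (hS : S.HasHjelmslevCounts q c) (hq : 2 ≤ q) {K : S.Point → ℕ} (hK : IsHyperoval q K)
    (x : S.Point) : lineMult (S := S.dual) (passants K) x = 0 ∨
      2 * lineMult (S := S.dual) (passants K) x = q ^ 2 := by
  classical
  rw [lineMult_passants]
  by_cases hx : K x = 0
  · right
    have h1 := hS.sum_pencil K x
    have h2 := sum_add_two_mul_card_zeros (Finset.univ.filter fun L => S.incident x L)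
      fun L _ => hS.hyperoval_lineMult hq hK L
    rw [hS.card_filter_incident] at h2
    rw [hS.hyperoval_classMult hq hK, hK.1, hx] at h1
    lia
  · left
    rw [Finset.card_eq_zero, Finset.filter_eq_empty_iff]
    intro L hL
    have := (hS.hyperoval_apply hq hK hx).2.2 L (by simpa using hL)
    lia

theorem HasHjelmslevCounts.size_passants [Fintype S.Point] [Fintype S.Line] [Fintype C]
    (hS : S.HasHjelmslevCounts q c) (hq : 2 ≤ q) {K : S.Point → ℕ} (hK : IsHyperoval q K) :
    2 * size (S := S.dual) (passants K) + q = q ^ 4 := by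
  classical
  have h0 : size (S := S.dual) (passants K) =
      (Finset.univ.filter fun L => lineMult K L = 0).card := by
    rw [Finset.card_filter]
    refine (@size_eq_sum S.dual (inferInstanceAs (Fintype S.Line)) (passants K)).trans ?_
    refine Finset.sum_congr rfl fun (L : S.Line) _ => ?_
    by_cases h : lineMult K L = 0 <;> simp [passants, IsPassant, h]
  have h1 := sum_add_two_mul_card_zeros (Finset.univ : Finset S.Line)
      fun L _ => hS.hyperoval_lineMult hq hK L
  have h2 : ∑ L, lineMult K L = (q ^ 2 + q) * (q ^ 2 + q + 1) := by
    simp only [lineMult_eq_sum]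
    rw [Finset.sum_comm, ← hK.1, size_eq_sum, Finset.mul_sum]
    refine Finset.sum_congr rfl fun x _ => ?_
    rw [← Finset.sum_filter, Finset.sum_const, hS.card_filter_incident, smul_eq_mul]
  rw [Finset.card_univ, ← Nat.card_eq_fintype_card, hS.card_line, h2, ← h0] at h1
  nlinarith

/-- The bound for arcs with at most `q ^ 2 / 2` points on every line. -/
theorem HasHjelmslevCounts.two_mul_add_le [Fintype S.Point] [Fintype S.Line] [Fintype C]
    (hS : S.HasHjelmslevCounts q c) (hq : 2 ≤ q) {K : S.Point → ℕ} {k n : ℕ}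
    (hn : 2 * n = q ^ 2) (hK : IsArc K k n) : 2 * k + q ≤ q ^ 4 := by
  classical
  by_contra! hk
  -- Averaging: `(q^4 - q) / (q^2 + q + 1) = q^2 - q`.
  obtain ⟨a, ha⟩ : ∃ a, q ^ 2 < 2 * classMult c K a + q := by
    by_contra! h
    have h1 : ∑ a : C, (2 * classMult c K a + q) ≤ ∑ _a : C, q ^ 2 :=
      Finset.sum_le_sum fun a _ => h a
    rw [Finset.sum_add_distrib, ← Finset.mul_sum, sum_classMult, hK.1, Finset.sum_const,
      Finset.sum_const, Finset.card_univ, ← Nat.card_eq_fintype_card, hS.card_class, smul_eq_mul,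
      smul_eq_mul] at h1
    nlinarith
  obtain ⟨x, rfl, hx⟩ : ∃ x, c x = a ∧ K x ≠ 0 := by
    refine exists_of_classMult_ne_zero fun h => ?_
    rw [h] at ha
    nlinarith
  have h1 := hS.sum_pencil K x
  have h2 : (∑ L with S.incident x L, lineMult K L) ≤ ∑ L with S.incident x L, n :=
    Finset.sum_le_sum fun L _ => hK.2 L
  rw [Finset.sum_const, hS.card_filter_incident, smul_eq_mul] at h2
  rw [hK.1] at h1
  have h3 : 1 ≤ K x := by lia
  generalize classMult c K (c x) = u at *
  -- `p = q - 1` is the coefficient of `u` in the pencil sum. Twice that sum exceeds `(q^4 - q) + (q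
  -- - 1)(q^2 - q) + 2q^2 = q^4 + q^3`, but it is at most `(q^2 + q) * 2n = q^4 + q^3`.
  obtain ⟨p, rfl⟩ : ∃ p, q = p + 1 := ⟨q - 1, by lia⟩
  have h4 : (p + 1) ^ 2 * 1 ≤ (p + 1) ^ 2 * K x := Nat.mul_le_mul_left _ h3
  have h5 : p * ((p + 1) ^ 2 + 1) ≤ p * (2 * u + (p + 1)) := Nat.mul_le_mul_left _ (by lia)
  have h6 : ((p + 1) ^ 2 + (p + 1)) * (2 * n) = ((p + 1) ^ 2 + (p + 1)) * (p + 1) ^ 2 := by rw [hn]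
  nlinarith

end Counting

/-! ### Transport along a duality -/

section Iso

variable {S T : IncidenceStructure}

theorem Iso.size_mapMultiset (σ : Iso S T) (K : S.Point → ℕ) : size (σ.mapMultiset K) = size K :=
  finsum_comp_equiv σ.onPoints.symm (f := K)

theorem Iso.lineMult_mapMultiset (σ : Iso S T) (K : S.Point → ℕ) (L : T.Line) :
    lineMult (σ.mapMultiset K) L = lineMult K (σ.onLines.symm L) := by
  rw [lineMult, lineMult, ← finsum_comp_equiv σ.onPoints.symm]
  refine finsum_congr fun x => ?_
  have : T.incident x L ↔ S.incident (σ.onPoints.symm x) (σ.onLines.symm L) := by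
    rw [← σ.incident_iff]
    simp
  simp only [this, mapMultiset]

theorem maxArcSize_eq {k n : ℕ} {K : S.Point → ℕ} (hK : IsProjective K) (h : IsMaximalArc K k n) :
    S.maxArcSize n = k :=
  IsGreatest.csSup_eq ⟨⟨K, hK, h.1⟩, fun k' ⟨K', _, hK'⟩ => h.2 k' K' hK'⟩

theorem isProjective_passants (K : S.Point → ℕ) : IsProjective (S := S.dual) (passants K) := by
  intro L
  unfold passants
  split_ifs <;> simp

/-- Passants of hyperovals, mapped by a duality. -/
theorem HasHjelmslevCounts.passants_map {q : ℕ} {C : Type} {c : S.Point → C} [Finite S.Point]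
    [Finite S.Line] [Finite C] (hS : S.HasHjelmslevCounts q c) (hq : 2 ≤ q) (hq2 : 2 ∣ q)
    {H : S.Point → ℕ} (hH : IsHyperoval q H) (σ : Iso S.dual S) :
    IsProjective (σ.mapMultiset (passants H)) ∧
    IsArc (σ.mapMultiset (passants H)) ((q ^ 4 - q) / 2) (q ^ 2 / 2) ∧
    (∀ L : S.Line, lineMult (σ.mapMultiset (passants H)) L = 0 ∨
      lineMult (σ.mapMultiset (passants H)) L = q ^ 2 / 2) ∧
    IsMaximalArc (σ.mapMultiset (passants H)) ((q ^ 4 - q) / 2) (q ^ 2 / 2) := by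
  have := Fintype.ofFinite S.Point
  have := Fintype.ofFinite S.Line
  have := Fintype.ofFinite C
  have hdiv : 2 * (q ^ 2 / 2) = q ^ 2 := Nat.mul_div_cancel' (dvd_pow hq2 two_ne_zero)
  have hL : ∀ L : S.Line, lineMult (σ.mapMultiset (passants H)) L = 0 ∨
      lineMult (σ.mapMultiset (passants H)) L = q ^ 2 / 2 := by
    intro L
    rw [σ.lineMult_mapMultiset]
    rcases hS.lineMult_passants_eq hq hH (σ.onLines.symm L) with h | h
    · exact Or.inl h
    · right
      lia
  have harc : IsArc (σ.mapMultiset (passants H)) ((q ^ 4 - q) / 2) (q ^ 2 / 2) := by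
    refine ⟨?_, fun L => ?_⟩
    · rw [σ.size_mapMultiset]
      have := hS.size_passants hq hH
      lia
    · rcases hL L with h | h <;> lia
  refine ⟨fun x => isProjective_passants H _, harc, hL, harc, fun k' K' hK' => ?_⟩
  have := hS.two_mul_add_le hq hdiv hK'
  lia

end Iso

end IncidenceStructure

/-! ### Reduction modulo 2, and its inheritance by monic extensions -/

/-- Reduction modulo `2` on a ring in which the multiples of `2` are the elements killed by `2`,
and in which `2` generates the maximal ideal. Galois rings of characteristic `4` have this
property. -/
structure IsReductionModTwo {R k : Type} [CommRing R] [CommRing k] (π : R →+* k) : Prop where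
  surjective : Function.Surjective π
  map_eq_zero_iff : ∀ x : R, π x = 0 ↔ 2 ∣ x
  two_mul_eq_zero_iff : ∀ x : R, 2 * x = 0 ↔ 2 ∣ x

theorem isReductionModTwo_zmod :
    IsReductionModTwo (ZMod.castHom (dvd_pow_self 2 two_ne_zero) (ZMod 2) : ZMod (2 ^ 2) →+* ZMod 2) where
  surjective := ZMod.castHom_surjective _
  map_eq_zero_iff := by decide
  two_mul_eq_zero_iff := by decide

theorem AdjoinRoot.map_mk {R k : Type} [CommRing R] [CommRing k] (π : R →+* k) (g p : R[X]) :
    AdjoinRoot.map π g (g.map π) dvd_rfl (AdjoinRoot.mk g p) =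
      AdjoinRoot.mk (g.map π) (p.map π) := by
  rw [AdjoinRoot.map, AdjoinRoot.lift_mk, ← AdjoinRoot.aeval_eq, aeval_def, eval₂_map]
  rfl

namespace IsReductionModTwo

variable {R k : Type} [CommRing R]

section

variable [CommRing k] {π : R →+* k} (hπ : IsReductionModTwo π)
include hπ

theorem two_mul_two : (2 * 2 : R) = 0 := (hπ.two_mul_eq_zero_iff 2).2 dvd_rfl

theorem two_mul_eq_iff {x y : R} : 2 * x = 2 * y ↔ π x = π y := by
  rw [← sub_eq_zero, ← mul_sub, hπ.two_mul_eq_zero_iff, ← hπ.map_eq_zero_iff, map_sub, sub_eq_zero]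

theorem exists_eq_add_two_mul {x y : R} (h : π x = π y) : ∃ z, x = y + 2 * z := by
  obtain ⟨z, hz⟩ := (hπ.map_eq_zero_iff (x - y)).1 (by rw [map_sub, h, sub_self])
  exact ⟨z, by rw [← hz]; ring⟩

theorem map_two : (2 : k) = 0 := by
  have := (hπ.map_eq_zero_iff 2).2 dvd_rfl
  rwa [map_ofNat] at this

theorem isUnit_of_map {a : R} (ha : IsUnit (π a)) : IsUnit a := by
  obtain ⟨b, hb⟩ := ha.exists_right_inv
  obtain ⟨b, rfl⟩ := hπ.surjective b
  obtain ⟨z, hz⟩ := hπ.exists_eq_add_two_mul (x := a * b) (y := 1) (by rw [map_mul, hb, map_one])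
  -- `1 + 2z` is its own inverse because `4 = 0`.
  refine IsUnit.of_mul_eq_one (b * (1 + 2 * z)) ?_
  rw [← mul_assoc, hz]
  linear_combination (z + z ^ 2) * hπ.two_mul_two

/-- Squares are determined by the residue class. -/
theorem sq_eq_sq {x y : R} (h : π x = π y) : x ^ 2 = y ^ 2 := by
  obtain ⟨z, rfl⟩ := hπ.exists_eq_add_two_mul h
  linear_combination (y * z + z ^ 2) * hπ.two_mul_two

/-- The reduction of polynomials. -/
theorem polynomial : IsReductionModTwo (Polynomial.mapRingHom π) where
  surjective := Polynomial.map_surjective π hπ.surjective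
  map_eq_zero_iff p := by
    rw [show (2 : R[X]) = C 2 from (map_ofNat C 2).symm, C_dvd_iff_dvd_coeff, Polynomial.ext_iff]
    simp [← hπ.map_eq_zero_iff]
  two_mul_eq_zero_iff p := by
    rw [show (2 : R[X]) = C 2 from (map_ofNat C 2).symm, C_dvd_iff_dvd_coeff, Polynomial.ext_iff]
    simp [← hπ.two_mul_eq_zero_iff]

theorem adjoinRoot [Nontrivial k] {g : R[X]} (hg : g.Monic) :
    IsReductionModTwo (AdjoinRoot.map π g (g.map π) dvd_rfl) where
  surjective := by
    intro y
    obtain ⟨p, rfl⟩ := AdjoinRoot.mk_surjective y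
    obtain ⟨p, rfl⟩ := Polynomial.map_surjective π hπ.surjective p
    exact ⟨AdjoinRoot.mk g p, AdjoinRoot.map_mk π g p⟩
  map_eq_zero_iff x := by
    obtain ⟨p, rfl⟩ := AdjoinRoot.mk_surjective x
    rw [AdjoinRoot.map_mk, AdjoinRoot.mk_eq_zero]
    constructor
    · rintro ⟨u, hu⟩
      obtain ⟨u, rfl⟩ := Polynomial.map_surjective π hπ.surjective u
      obtain ⟨v, hv⟩ := hπ.polynomial.exists_eq_add_two_mul (x := p) (y := g * u) (by simpa using hu)
      refine ⟨AdjoinRoot.mk g v, ?_⟩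
      rw [hv, map_add, map_mul, AdjoinRoot.mk_self, map_mul, map_ofNat]
      ring
    · rintro ⟨y, hy⟩
      obtain ⟨v, rfl⟩ := AdjoinRoot.mk_surjective y
      rw [← AdjoinRoot.mk_eq_zero, ← AdjoinRoot.map_mk, hy, map_mul, map_ofNat, ← map_ofNat (AdjoinRoot.of _),
        hπ.map_two]
      simp
  two_mul_eq_zero_iff x := by
    have := hπ.surjective.nontrivial
    obtain ⟨p, rfl⟩ := AdjoinRoot.mk_surjective x
    constructor
    · intro h
      have h0 : AdjoinRoot.mk g p = AdjoinRoot.mk g (p %ₘ g) := by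
        rw [AdjoinRoot.mk_eq_mk]
        exact ⟨p /ₘ g, by linear_combination (modByMonic_add_div p g).symm⟩
      rw [h0] at h ⊢
      rw [← map_ofNat (AdjoinRoot.mk g), ← map_mul, AdjoinRoot.mk_eq_zero] at h
      -- A multiple of the monic `g` of degree below that of `g` vanishes, so the problem descends
      -- to coefficients.
      have h2 : 2 * (p %ₘ g) = 0 := by
        by_contra hne
        refine hg.not_dvd_of_degree_lt hne ?_ h
        rw [show (2 : R[X]) = C 2 from (map_ofNat C 2).symm, ← smul_eq_C_mul]
        exact (degree_smul_le _ _).trans_lt (degree_modByMonic_lt _ hg)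
      obtain ⟨v, hv⟩ := (hπ.polynomial.two_mul_eq_zero_iff _).1 h2
      exact ⟨AdjoinRoot.mk g v, by rw [hv, map_mul, map_ofNat]⟩
    · rintro ⟨y, hy⟩
      rw [hy, ← mul_assoc, ← map_ofNat (AdjoinRoot.of g), ← map_mul, hπ.two_mul_two]
      simp

/-- Multiplication by `2` has both kernel and image equal to `2R = ker π`, so it induces a bijection
from `k` onto `ker π`. -/
theorem card_ker_eq : Nat.card {x // π x = 0} = Nat.card k := by
  let f : k → {x // π x = 0} := fun a =>
    ⟨2 * Function.surjInv hπ.surjective a, (hπ.map_eq_zero_iff _).2 ⟨_, rfl⟩⟩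
  refine (Nat.card_congr (Equiv.ofBijective f ⟨fun a b hab => ?_, fun x => ?_⟩)).symm
  · have := congrArg Subtype.val hab
    rwa [hπ.two_mul_eq_iff, Function.surjInv_eq hπ.surjective,
      Function.surjInv_eq hπ.surjective] at this
  · obtain ⟨y, hy⟩ := (hπ.map_eq_zero_iff _).1 x.2
    refine ⟨π y, Subtype.ext ?_⟩
    rw [hy]
    exact hπ.two_mul_eq_iff.2 (Function.surjInv_eq _ _)

end

end IsReductionModTwo

/-- The cardinality of the domain of a surjective homomorphism. -/
theorem AddMonoidHom.card_eq_card_ker_mul {A B : Type} [AddCommGroup A] [AddCommGroup B]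
    (f : A →+ B) (hf : Function.Surjective f) :
    Nat.card A = Nat.card {a // f a = 0} * Nat.card B := by
  have h1 := f.ker.card_mul_index
  rw [AddSubgroup.index_ker, AddMonoidHom.range_eq_top.2 hf, AddSubgroup.card_top] at h1
  exact h1.symm

theorem IsReductionModTwo.card_eq {R k : Type} [CommRing R] [CommRing k] {π : R →+* k}
    (hπ : IsReductionModTwo π) : Nat.card R = Nat.card k ^ 2 := by
  have := (π : R →+ k).card_eq_card_ker_mul hπ.surjective
  rw [this, sq]
  exact congrArg (· * Nat.card k) hπ.card_ker_eq

/-! ### Orthogonality and cross products in `R^3` -/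

open scoped Matrix LinearAlgebra.Projectivization

section Orthogonality

variable {R : Type} [CommRing R]

/-- The orthogonal submodule with respect to the dot product. -/
def perp (N : Submodule R (Fin 3 → R)) : Submodule R (Fin 3 → R) where
  carrier := {y | ∀ x ∈ N, x ⬝ᵥ y = 0}
  zero_mem' x _ := dotProduct_zero x
  add_mem' {y z} hy hz x hx := by rw [dotProduct_add, hy x hx, hz x hx, add_zero]
  smul_mem' a y hy x hx := by rw [dotProduct_smul, hy x hx, smul_zero]

theorem mem_perp {N : Submodule R (Fin 3 → R)} {y : Fin 3 → R} :
    y ∈ perp N ↔ ∀ x ∈ N, x ⬝ᵥ y = 0 := Iff.rfl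

theorem mem_perp_span_singleton {x y : Fin 3 → R} :
    y ∈ perp (Submodule.span R {x}) ↔ x ⬝ᵥ y = 0 := by
  rw [mem_perp]
  refine ⟨fun h => h x (Submodule.mem_span_singleton_self x), fun h z hz => ?_⟩
  obtain ⟨a, rfl⟩ := Submodule.mem_span_singleton.1 hz
  rw [smul_dotProduct, h, smul_zero]

theorem perp_le_perp {M N : Submodule R (Fin 3 → R)} (h : M ≤ N) : perp N ≤ perp M :=
  fun _ hy x hx => hy x (h hx)

/-- Expanding `(x × y) × w = (x · w) y - (y · w) x` gives `a = y · w`. The condition `x · w = 1`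
replaces `x ≠ 0` over a ring. -/
theorem exists_smul_of_cross_eq_zero {x y w : Fin 3 → R} (hw : x ⬝ᵥ w = 1) (h : x ⨯₃ y = 0) :
    ∃ a : R, y = a • x := by
  have h1 := cross_cross_eq_smul_sub_smul x y w
  rw [h, hw, one_smul, map_zero, LinearMap.zero_apply] at h1
  exact ⟨y ⬝ᵥ w, (sub_eq_zero.1 h1.symm)⟩

theorem perp_perp_span_singleton {x w : Fin 3 → R} (hw : x ⬝ᵥ w = 1) :
    perp (perp (Submodule.span R {x})) = Submodule.span R {x} := by
  refine le_antisymm (fun y hy => ?_) (fun y hy z hz => by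
    rw [dotProduct_comm]; exact hz y hy)
  -- All vectors `x × v` are orthogonal to `x`, hence to `y`; permuting the triple product turns
  -- this into `y × x = 0`.
  have h1 : ∀ v, (y ⨯₃ x) ⬝ᵥ v = 0 := by
    intro v
    rw [dotProduct_comm, triple_product_permutation, dotProduct_comm]
    exact hy _ (mem_perp_span_singleton.2 (dot_self_cross x v))
  have h2 : x ⨯₃ y = 0 := by
    rw [← cross_anticomm, dotProduct_eq_zero _ h1, neg_zero]
  obtain ⟨a, rfl⟩ := exists_smul_of_cross_eq_zero hw h2
  exact Submodule.smul_mem _ a (Submodule.mem_span_singleton_self x)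

theorem map_cross {k : Type} [CommRing k] (π : R →+* k) (x y : Fin 3 → R) :
    π ∘ (x ⨯₃ y) = (π ∘ x) ⨯₃ (π ∘ y) := by
  ext i
  fin_cases i <;> simp [cross_apply]

theorem Module.natCard_eq_pow_finrank_of_free {M : Type} [AddCommGroup M] [Module R M]
    [Nontrivial R] [Module.Finite R M] [Module.Free R M] {n : ℕ} (h : Module.finrank R M = n) :
    Nat.card M = Nat.card R ^ n := by
  rw [Nat.card_congr (Module.finBasisOfFinrankEq R M h).equivFun.toEquiv, Nat.card_fun, Nat.card_fin]

end Orthogonality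

theorem natCard_and_add_natCard_and_not {α : Type} [Finite α] (p r : α → Prop) :
    Nat.card {a // p a ∧ r a} + Nat.card {a // ¬ p a ∧ r a} = Nat.card {a // r a} := by
  classical
  have := Fintype.ofFinite α
  simp only [Nat.card_eq_fintype_card, Fintype.card_subtype]
  rw [← Finset.card_filter_add_card_filter_not (s := Finset.univ.filter fun a => r a) p,
    Finset.filter_filter, Finset.filter_filter]
  simp only [and_comm]

/-- Counting the domain of a surjection with fibres of constant size. -/
theorem natCard_subtype_comp {α β : Type} [Finite α] [Finite β] (f : α → β) (T : β → Prop) {m : ℕ}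
    (hf : ∀ b, Nat.card {a // f a = b} = m) :
    Nat.card {a // T (f a)} = Nat.card {b // T b} * m := by
  classical
  have := Fintype.ofFinite α
  have := Fintype.ofFinite β
  simp only [Nat.card_eq_fintype_card, Fintype.card_subtype] at hf ⊢
  rw [Finset.card_eq_sum_card_fiberwise (f := f) (t := Finset.univ.filter T)
    (fun a ha => by simpa using ha)]
  refine Finset.sum_const_nat fun b hb => ?_
  rw [← hf b, Finset.filter_filter]
  congr 1
  ext a
  simp only [Finset.mem_filter, Finset.mem_univ, true_and] at hb ⊢
  exact ⟨fun h => h.2, fun h => ⟨h ▸ hb, h⟩⟩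

/-! ### Points and lines given by unimodular vectors -/

namespace IsReductionModTwo

variable {R k : Type} [CommRing R] [Field k] {π : R →+* k} (hπ : IsReductionModTwo π)
include hπ

theorem nontrivial : Nontrivial R := hπ.surjective.nontrivial

theorem isUnit_iff {a : R} : IsUnit a ↔ π a ≠ 0 :=
  ⟨fun h => (h.map π).ne_zero, fun h => hπ.isUnit_of_map (isUnit_iff_ne_zero.2 h)⟩

theorem isLocalRing : IsLocalRing R :=
  have : IsLocalHom π := ⟨fun _ => hπ.isUnit_of_map⟩
  π.domain_isLocalRing

theorem exists_dotProduct_eq_one {x : Fin 3 → R} (hx : π ∘ x ≠ 0) :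
    ∃ w : Fin 3 → R, x ⬝ᵥ w = 1 := by
  obtain ⟨i, hi⟩ := Function.ne_iff.1 hx
  obtain ⟨b, hb⟩ := (hπ.isUnit_iff.2 hi).exists_right_inv
  exact ⟨Pi.single i b, by rw [dotProduct_single, hb]⟩

theorem exists_smul_of_map_cross_eq_zero {x y : Fin 3 → R} (hx : π ∘ x ≠ 0)
    (h : π ∘ (x ⨯₃ y) = 0) : ∃ (a : R) (z : Fin 3 → R), y = a • x + 2 • z := by
  obtain ⟨w, hw⟩ := hπ.exists_dotProduct_eq_one hx
  rw [map_cross] at h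
  have hw' : (π ∘ x) ⬝ᵥ (π ∘ w) = 1 := by rw [← RingHom.map_dotProduct, hw, map_one]
  obtain ⟨a, ha⟩ := exists_smul_of_cross_eq_zero hw' h
  obtain ⟨a, rfl⟩ := hπ.surjective a
  have : ∀ i, ∃ z, y i = a * x i + 2 * z := fun i =>
    hπ.exists_eq_add_two_mul (by simpa using congrFun ha i)
  choose z hz using this
  exact ⟨a, z, by ext i; simp [hz i]⟩

theorem exists_eq_two_smul {x : Fin 3 → R} (hx : π ∘ x = 0) :
    ∃ z : Fin 3 → R, x = (2 : R) • z := by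
  have : ∀ i, ∃ z, x i = 2 * z := fun i => (hπ.map_eq_zero_iff _).1 (congrFun hx i)
  choose z hz using this
  exact ⟨z, by ext i; simp [hz i]⟩

theorem span_eq_of_eq_smul {x y : Fin 3 → R} (hy : π ∘ y ≠ 0) {a : R} (h : y = a • x) :
    Submodule.span R {y} = Submodule.span R {x} := by
  have ha : IsUnit a := by
    rw [hπ.isUnit_iff]
    intro h0
    apply hy
    ext i
    simp [h, h0]
  rw [h]
  exact Submodule.span_singleton_smul_eq ha x

theorem smul_eq_zero {x : Fin 3 → R} (hx : π ∘ x ≠ 0) {a : R} (h : a • x = 0) : a = 0 := by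
  obtain ⟨w, hw⟩ := hπ.exists_dotProduct_eq_one hx
  rw [← mul_one a, ← hw, ← smul_eq_mul, ← smul_dotProduct, h, zero_dotProduct]

theorem isPoint_span {x : Fin 3 → R} (hx : π ∘ x ≠ 0) :
    Module.Free R (Submodule.span R {x}) ∧ Module.finrank R (Submodule.span R {x}) = 1 := by
  have := hπ.nontrivial
  have hinj : Function.Injective (LinearMap.toSpanSingleton R (Fin 3 → R) x) := by
    rw [← LinearMap.ker_eq_bot, LinearMap.ker_eq_bot']
    exact fun a ha => hπ.smul_eq_zero hx ha
  have e := LinearEquiv.ofInjective _ hinj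
  rw [LinearMap.range_toSpanSingleton] at e
  exact ⟨Module.Free.of_equiv e, e.finrank_eq.symm.trans (Module.finrank_self R)⟩

theorem card_dotProduct_eq_zero {x : Fin 3 → R} (hx : π ∘ x ≠ 0) [Finite R] :
    Nat.card {y // x ⬝ᵥ y = 0} = Nat.card R ^ 2 := by
  have := hπ.nontrivial
  obtain ⟨w, hw⟩ := hπ.exists_dotProduct_eq_one hx
  let f : (Fin 3 → R) →+ R :=
    { toFun := fun y => x ⬝ᵥ y, map_zero' := dotProduct_zero x, map_add' := dotProduct_add x }
  have h1 := f.card_eq_card_ker_mul fun a => ⟨a • w, by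
    change x ⬝ᵥ (a • w) = a
    rw [dotProduct_smul, hw, smul_eq_mul, mul_one]⟩
  rw [Nat.card_fun, Nat.card_fin, pow_succ] at h1
  exact (Nat.eq_of_mul_eq_mul_right Nat.card_pos h1).symm

theorem card_perp_span [Finite R] {x : Fin 3 → R} (hx : π ∘ x ≠ 0) :
    Nat.card (perp (Submodule.span R {x})) = Nat.card R ^ 2 := by
  rw [← hπ.card_dotProduct_eq_zero hx]
  exact Nat.card_congr (Equiv.subtypeEquivRight fun y => mem_perp_span_singleton)

theorem isLine_perp_span [Finite R] {x : Fin 3 → R} (hx : π ∘ x ≠ 0) :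
    Module.Free R (perp (Submodule.span R {x})) ∧
      Module.finrank R (perp (Submodule.span R {x})) = 2 := by
  have := hπ.nontrivial
  have := hπ.isLocalRing
  obtain ⟨w, hw⟩ := hπ.exists_dotProduct_eq_one hx
  -- A projection of `R^3` onto `perp`. Thus `perp` is projective, hence free over the local ring
  -- `R`; the rank is then read off from the cardinality.
  let s : (Fin 3 → R) →ₗ[R] perp (Submodule.span R {x}) :=
    { toFun := fun y => ⟨y - (x ⬝ᵥ y) • w, by
        rw [mem_perp_span_singleton, dotProduct_sub, dotProduct_smul, hw, smul_eq_mul, mul_one,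
          sub_self]⟩
      map_add' := fun y z => by
        ext i
        simp only [dotProduct_add, add_smul, Submodule.coe_add, Pi.add_apply, Pi.sub_apply]
        ring
      map_smul' := fun a y => by
        ext i
        simp only [dotProduct_smul, Submodule.coe_smul, Pi.smul_apply, Pi.sub_apply, smul_eq_mul,
          RingHom.id_apply]
        ring }
  have hs : s.comp (Submodule.subtype _) = LinearMap.id := by
    ext y : 2
    have := mem_perp_span_singleton.1 y.2
    simp [s, this]
  have : Module.Projective R (perp (Submodule.span R {x})) := Module.Projective.of_split _ s hs
  have hfree : Module.Free R (perp (Submodule.span R {x})) := Module.free_of_flat_of_isLocalRing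
  refine ⟨hfree, ?_⟩
  have h1 := Module.natCard_eq_pow_finrank_of_free (R := R) (M := perp (Submodule.span R {x})) rfl
  rw [hπ.card_perp_span hx] at h1
  exact (Nat.pow_right_injective (Finite.one_lt_card (α := R)) h1).symm

theorem exists_eq_span {N : Submodule R (Fin 3 → R)} [Finite R]
    (hN : Module.Free R N ∧ Module.finrank R N = 1) :
    ∃ x : Fin 3 → R, π ∘ x ≠ 0 ∧ N = Submodule.span R {x} := by
  have := hπ.nontrivial
  have := hN.1
  let b := Module.finBasisOfFinrankEq R N hN.2
  refine ⟨b 0, fun h => ?_, ?_⟩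
  · obtain ⟨z, hz⟩ := hπ.exists_eq_two_smul h
    have h2 : (2 : R) • b 0 = 0 := by
      ext1
      rw [Submodule.coe_smul, hz, smul_smul, hπ.two_mul_two, zero_smul, Submodule.coe_zero]
    have h3 := congrArg (fun v => b.repr v 0) h2
    have h4 : (2 : R) * 1 = 0 := by simpa using h3
    rw [hπ.two_mul_eq_zero_iff, ← hπ.map_eq_zero_iff, map_one] at h4
    exact one_ne_zero h4
  · have h1 := congrArg (Submodule.map N.subtype) b.span_eq
    rw [Submodule.map_span, ← Set.range_comp, Submodule.map_subtype_top] at h1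
    refine h1.symm.trans (congrArg _ ?_)
    ext v
    simp [eq_comm]

/-- A dependency modulo `2` lifts to `a u + b v = 2z`. Doubling it gives `2a = 2b = 0` by
independence over `R`, so `a` and `b` vanish in `k`. -/
theorem map_cross_ne_zero {u v : Fin 3 → R} (h : ∀ a b : R, a • u + b • v = 0 → a = 0 ∧ b = 0) :
    π ∘ (u ⨯₃ v) ≠ 0 := by
  rw [map_cross, crossProduct_ne_zero_iff_linearIndependent, LinearIndependent.pair_iff]
  intro α β hαβ
  obtain ⟨a, rfl⟩ := hπ.surjective α
  obtain ⟨b, rfl⟩ := hπ.surjective β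
  obtain ⟨z, hz⟩ := hπ.exists_eq_two_smul (x := a • u + b • v) (by
    ext i
    simpa using congrFun hαβ i)
  have h1 := h (2 * a) (2 * b) (by
    rw [mul_smul, mul_smul, ← smul_add, hz, smul_smul, hπ.two_mul_two, zero_smul])
  rwa [hπ.two_mul_eq_zero_iff, hπ.two_mul_eq_zero_iff, ← hπ.map_eq_zero_iff,
    ← hπ.map_eq_zero_iff] at h1

theorem exists_eq_perp_span [Finite R] {N : Submodule R (Fin 3 → R)}
    (hN : Module.Free R N ∧ Module.finrank R N = 2) :
    ∃ x : Fin 3 → R, π ∘ x ≠ 0 ∧ N = perp (Submodule.span R {x}) := by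
  have := hπ.nontrivial
  have := hN.1
  let b := Module.finBasisOfFinrankEq R N hN.2
  have hx : π ∘ ((b 0 : Fin 3 → R) ⨯₃ (b 1 : Fin 3 → R)) ≠ 0 := by
    refine hπ.map_cross_ne_zero fun a c hac => ?_
    have h1 : a • b 0 + c • b 1 = 0 := by
      ext1
      simpa using hac
    have h2 := fun i => congrArg (fun v => b.repr v i) h1
    exact ⟨by simpa using h2 0, by simpa using h2 1⟩
  refine ⟨_, hx, ?_⟩
  -- The line lies in `perp` of the cross product of its basis, and both have `|R|^2` elements.
  refine SetLike.coe_injective (Set.eq_of_subset_of_ncard_le (fun y hy => ?_) ?_)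
  · rw [SetLike.mem_coe, mem_perp_span_singleton]
    have h1 := b.sum_repr ⟨y, hy⟩
    rw [Fin.sum_univ_two] at h1
    have h2 := congrArg Subtype.val h1
    simp only [Submodule.coe_add, Submodule.coe_smul] at h2
    rw [← h2, dotProduct_add, dotProduct_smul, dotProduct_smul, dotProduct_comm, dot_self_cross,
      dotProduct_comm, dot_cross_self]
    simp
  · have h1 := hπ.card_perp_span hx
    have h2 := Module.natCard_eq_pow_finrank_of_free (R := R) (M := N) hN.2
    rw [← Nat.card_coe_set_eq, ← Nat.card_coe_set_eq]
    exact (h1.trans h2.symm).le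

end IsReductionModTwo

theorem PHG.incident_iff {R : Type} [CommRing R] {N : (PHG R).Point} {L : (PHG R).Line} {x y : Fin 3 → R}
    (hN : N.1 = Submodule.span R {x}) (hL : L.1 = perp (Submodule.span R {y})) :
    (PHG R).incident N L ↔ x ⬝ᵥ y = 0 := by
  change N.1 ≤ L.1 ↔ _
  rw [hN, hL, Submodule.span_singleton_le_iff_mem, mem_perp_span_singleton, dotProduct_comm]

theorem Projectivization.mk_eq_mk_iff_cross {k : Type} [Field k] {x y : Fin 3 → k} (hx : x ≠ 0)
    (hy : y ≠ 0) : Projectivization.mk k x hx = Projectivization.mk k y hy ↔ x ⨯₃ y = 0 := by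
  constructor
  · rw [Projectivization.mk_eq_mk_iff']
    rintro ⟨a, rfl⟩
    simp
  · intro h
    obtain ⟨i, hi⟩ := Function.ne_iff.1 hx
    obtain ⟨a, ha⟩ := exists_smul_of_cross_eq_zero (w := Pi.single i (x i)⁻¹)
      (by rw [dotProduct_single, mul_inv_cancel₀ hi]) h
    exact ((Projectivization.mk_eq_mk_iff' _ _ _ _ _).2 ⟨a, ha.symm⟩).symm

theorem RingHom.card_map_ne_zero_pos {R k : Type} [CommRing R] [Field k] [_root_.Finite R] (π : R →+* k) :
    0 < Nat.card {a // π a ≠ 0} := by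
  have : Nonempty {a // π a ≠ 0} := ⟨⟨1, by simp⟩⟩
  exact Nat.card_pos

instance PHG.finite_line (R : Type) [CommRing R] [Finite R] : Finite (PHG R).Line :=
  inferInstanceAs (Finite {_N : Submodule R (Fin 3 → R) // _})

/-! ### Self-duality and the counts for the Hjelmslev plane -/

namespace IsReductionModTwo

variable {R k : Type} [CommRing R] [Field k] {π : R →+* k} (hπ : IsReductionModTwo π)
include hπ

/-- The point generated by a unimodular vector. -/
def point (x : {x : Fin 3 → R // π ∘ x ≠ 0}) : (PHG R).Point :=
  ⟨Submodule.span R {x.1}, hπ.isPoint_span x.2⟩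

/-- Solutions divisible by `2` correspond to solutions over the residue field. -/
theorem card_map_eq_zero_and (Q : (Fin 3 → R) → Prop) (Q' : (Fin 3 → k) → Prop)
    (hQ : ∀ z, Q ((2 : R) • z) ↔ Q' (π ∘ z)) :
    Nat.card {y // π ∘ y = 0 ∧ Q y} = Nat.card {w // Q' w} := by
  let s : (Fin 3 → k) → (Fin 3 → R) := fun w i => Function.surjInv hπ.surjective (w i)
  have hs : ∀ w, π ∘ s w = w := fun w => funext fun i => Function.surjInv_eq hπ.surjective _
  let f : {w // Q' w} → {y // π ∘ y = 0 ∧ Q y} := fun w => ⟨(2 : R) • s w.1, by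
    ext i
    simp [(hπ.map_eq_zero_iff 2).2 dvd_rfl], by
    rw [hQ, hs]
    exact w.2⟩
  refine (Nat.card_congr (Equiv.ofBijective f ⟨fun v w hvw => ?_, fun y => ?_⟩)).symm
  · ext i
    have h1 : 2 * s v.1 i = 2 * s w.1 i := congrFun (congrArg Subtype.val hvw) i
    rw [hπ.two_mul_eq_iff] at h1
    exact (congrFun (hs v.1) i).symm.trans (h1.trans (congrFun (hs w.1) i))
  · obtain ⟨z, hz⟩ := hπ.exists_eq_two_smul y.2.1
    refine ⟨⟨π ∘ z, by rw [← hQ, ← hz]; exact y.2.2⟩, Subtype.ext ?_⟩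
    refine Eq.trans ?_ hz.symm
    ext i
    exact hπ.two_mul_eq_iff.2 (congrFun (hs (π ∘ z)) i)

variable [Finite R]

/-- The line orthogonal to a unimodular vector. -/
def line (x : {x : Fin 3 → R // π ∘ x ≠ 0}) : (PHG R).Line :=
  ⟨perp (Submodule.span R {x.1}), hπ.isLine_perp_span x.2⟩

theorem perp_perp_of_point (N : (PHG R).Point) : perp (perp N.1) = N.1 := by
  obtain ⟨x, hx, hN⟩ := hπ.exists_eq_span N.2
  obtain ⟨w, hw⟩ := hπ.exists_dotProduct_eq_one hx
  rw [hN, perp_perp_span_singleton hw]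

theorem perp_perp_of_line (L : (PHG R).Line) : perp (perp L.1) = L.1 := by
  obtain ⟨x, hx, hL⟩ := hπ.exists_eq_perp_span L.2
  obtain ⟨w, hw⟩ := hπ.exists_dotProduct_eq_one hx
  rw [hL, perp_perp_span_singleton hw]

/-- The polarity interchanging points and lines. -/
def pointEquivLine : (PHG R).Point ≃ (PHG R).Line where
  toFun N := ⟨perp N.1, by
    obtain ⟨x, hx, hN⟩ := hπ.exists_eq_span N.2
    rw [hN]
    exact hπ.isLine_perp_span hx⟩
  invFun L := ⟨perp L.1, by
    obtain ⟨x, hx, hL⟩ := hπ.exists_eq_perp_span L.2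
    obtain ⟨w, hw⟩ := hπ.exists_dotProduct_eq_one hx
    rw [hL, perp_perp_span_singleton hw]
    exact hπ.isPoint_span hx⟩
  left_inv N := Subtype.ext (hπ.perp_perp_of_point N)
  right_inv L := Subtype.ext (hπ.perp_perp_of_line L)

/-- The projective Hjelmslev plane is self-dual. -/
def dualIso : (PHG R).dual.Iso (PHG R) where
  onPoints := hπ.pointEquivLine.symm
  onLines := hπ.pointEquivLine
  incident_iff L N := by
    change perp L.1 ≤ perp N.1 ↔ N.1 ≤ L.1
    refine ⟨fun h => ?_, perp_le_perp⟩
    rw [← hπ.perp_perp_of_point N, ← hπ.perp_perp_of_line L]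
    exact perp_le_perp h

theorem card_map_ne_zero_add : Nat.card {a // π a ≠ 0} + Nat.card k = Nat.card k ^ 2 := by
  have h1 := natCard_and_add_natCard_and_not (fun a => π a = 0) (fun _ : R => True)
  simp only [and_true, Nat.card_subtype_true] at h1
  rw [hπ.card_ker_eq, hπ.card_eq] at h1
  rw [← h1, add_comm]

/-- The units act simply transitively on the generators of a point. -/
theorem card_point_fibre (N : (PHG R).Point) :
    Nat.card {x // hπ.point x = N} = Nat.card {a // π a ≠ 0} := by
  obtain ⟨x, hx, hN⟩ := hπ.exists_eq_span N.2
  have hsmul : ∀ a : R, π a ≠ 0 → π ∘ (a • x) ≠ 0 := by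
    intro a ha h
    refine hx (funext fun i => ?_)
    have : π a * π (x i) = 0 := by simpa using congrFun h i
    exact (mul_eq_zero.1 this).resolve_left ha
  let f : {a // π a ≠ 0} → {x // hπ.point x = N} := fun a =>
    ⟨⟨a.1 • x, hsmul a a.2⟩, Subtype.ext <| by
      rw [hN]
      exact hπ.span_eq_of_eq_smul (hsmul a a.2) rfl⟩
  refine (Nat.card_congr (Equiv.ofBijective f ⟨fun a b hab => ?_, fun y => ?_⟩)).symm
  · have h1 : a.1 • x = b.1 • x := congrArg (fun z => z.1.1) hab
    rw [← sub_eq_zero, ← sub_smul] at h1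
    exact Subtype.ext (sub_eq_zero.1 (hπ.smul_eq_zero hx h1))
  · have h1 : y.1.1 ∈ Submodule.span R {x} :=
      hN.le ((congrArg Subtype.val y.2).le (Submodule.mem_span_singleton_self _))
    obtain ⟨a, ha⟩ := Submodule.mem_span_singleton.1 h1
    refine ⟨⟨a, fun h => y.1.2 ?_⟩, Subtype.ext (Subtype.ext ha)⟩
    ext i
    rw [← ha]
    simp [h]

theorem line_eq (x : {x : Fin 3 → R // π ∘ x ≠ 0}) :
    hπ.line x = hπ.pointEquivLine (hπ.point x) := rfl

theorem card_line_fibre (L : (PHG R).Line) :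
    Nat.card {x // hπ.line x = L} = Nat.card {a // π a ≠ 0} := by
  rw [← hπ.card_point_fibre (hπ.pointEquivLine.symm L)]
  exact Nat.card_congr (Equiv.subtypeEquivRight fun x => by
    rw [line_eq, Equiv.eq_symm_apply])

/-- Counting lines by counting their normal vectors. -/
theorem card_lines_mul (T : (PHG R).Line → Prop) (Q : (Fin 3 → R) → Prop)
    (hTQ : ∀ x, T (hπ.line x) ↔ Q x.1) :
    Nat.card {L // T L} * Nat.card {a // π a ≠ 0} + Nat.card {y // π ∘ y = 0 ∧ Q y} =
      Nat.card {y // Q y} := by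
  rw [← natCard_and_add_natCard_and_not (fun y => π ∘ y = 0) Q, add_comm,
    ← natCard_subtype_comp hπ.line T hπ.card_line_fibre]
  congr 1
  refine Nat.card_congr ((Equiv.subtypeEquivRight fun x => hTQ x).trans ?_)
  exact Equiv.subtypeSubtypeEquivSubtypeInter _ Q

theorem finite_residue : Finite k := Finite.of_surjective π hπ.surjective

theorem card_lines : Nat.card (PHG R).Line =
    Nat.card k ^ 2 * (Nat.card k ^ 2 + Nat.card k + 1) := by
  have h1 := hπ.card_lines_mul (fun _ => True) (fun _ => True) fun _ => Iff.rfl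
  rw [hπ.card_map_eq_zero_and (fun _ => True) (fun _ => True) fun _ => Iff.rfl] at h1
  simp only [Nat.card_subtype_true, Nat.card_fun, Nat.card_fin, hπ.card_eq] at h1
  have h2 := hπ.card_map_ne_zero_add
  refine Nat.eq_of_mul_eq_mul_right π.card_map_ne_zero_pos ?_
  generalize Nat.card {a // π a ≠ 0} = u at *
  generalize Nat.card k = q at *
  zify at *
  linear_combination h1 - q ^ 2 * (q ^ 2 + q + 1) * h2

theorem card_dotProduct_eq_zero_field {x : Fin 3 → k} (hx : x ≠ 0) :
    Nat.card {y // x ⬝ᵥ y = 0} = Nat.card k ^ 2 := by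
  have := hπ.finite_residue
  obtain ⟨i, hi⟩ := Function.ne_iff.1 hx
  let f : (Fin 3 → k) →+ k :=
    { toFun := fun y => x ⬝ᵥ y, map_zero' := dotProduct_zero x, map_add' := dotProduct_add x }
  have h1 := f.card_eq_card_ker_mul fun a => ⟨Pi.single i ((x i)⁻¹ * a), by
    change x ⬝ᵥ _ = a
    rw [dotProduct_single, mul_inv_cancel_left₀ hi]⟩
  rw [Nat.card_fun, Nat.card_fin, pow_succ] at h1
  exact (Nat.eq_of_mul_eq_mul_right Nat.card_pos h1).symm

theorem card_map_eq_zero_dotProduct {x : Fin 3 → R} (hx : π ∘ x ≠ 0) :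
    Nat.card {y // π ∘ y = 0 ∧ x ⬝ᵥ y = 0} = Nat.card k ^ 2 := by
  rw [← hπ.card_dotProduct_eq_zero_field hx]
  refine hπ.card_map_eq_zero_and _ _ fun z => ?_
  rw [dotProduct_smul, smul_eq_mul, hπ.two_mul_eq_zero_iff, ← hπ.map_eq_zero_iff,
    RingHom.map_dotProduct]

/-- Of the `q^4` normal vectors orthogonal to `x`, exactly `q^2` are divisible by `2`; the others
fall into unit orbits of size `q^2 - q`. -/
theorem card_pencil (N : (PHG R).Point) :
    Nat.card {L // (PHG R).incident N L} = Nat.card k ^ 2 + Nat.card k := by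
  obtain ⟨x, hx, hN⟩ := hπ.exists_eq_span N.2
  have h1 := hπ.card_lines_mul (fun L => (PHG R).incident N L) (fun y => x ⬝ᵥ y = 0)
    fun y => PHG.incident_iff hN rfl
  rw [hπ.card_map_eq_zero_dotProduct hx, hπ.card_dotProduct_eq_zero hx, hπ.card_eq] at h1
  have h2 := hπ.card_map_ne_zero_add
  refine Nat.eq_of_mul_eq_mul_right π.card_map_ne_zero_pos ?_
  generalize Nat.card {a // π a ≠ 0} = u at *
  generalize Nat.card k = q at *
  zify at *
  linear_combination h1 - (q ^ 2 + q) * h2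

/-- Common normal vectors of two neighbouring points. -/
theorem card_joint_solutions {x z : Fin 3 → R} (hx : π ∘ x ≠ 0) (hz : π ∘ (x ⨯₃ z) ≠ 0) :
    Nat.card {y // x ⬝ᵥ y = 0 ∧ π (z ⬝ᵥ y) = 0} = Nat.card k ^ 3 := by
  have := hπ.finite_residue
  let f : perp (Submodule.span R {x}) →+ k :=
    { toFun := fun y => π (z ⬝ᵥ y.1)
      map_zero' := by simp
      map_add' := fun y y' => by simp [dotProduct_add] }
  obtain ⟨v, hv⟩ := hπ.exists_dotProduct_eq_one hz
  -- `v × x` is orthogonal to `x` and pairs to `1` with `z`, so its multiples make `f` surjective.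
  have hmem : v ⨯₃ x ∈ perp (Submodule.span R {x}) :=
    mem_perp_span_singleton.2 (dot_cross_self v x)
  have hone : z ⬝ᵥ (v ⨯₃ x) = 1 := by
    rw [triple_product_permutation, dotProduct_comm, hv]
  have hsurj : Function.Surjective f := by
    intro a
    obtain ⟨a, rfl⟩ := hπ.surjective a
    refine ⟨⟨a • (v ⨯₃ x), Submodule.smul_mem _ a hmem⟩, ?_⟩
    change π (z ⬝ᵥ (a • (v ⨯₃ x))) = _
    rw [dotProduct_smul, hone, smul_eq_mul, mul_one]
  have h1 := f.card_eq_card_ker_mul hsurj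
  rw [hπ.card_perp_span hx, hπ.card_eq, ← pow_mul, pow_succ] at h1
  have h2 : Nat.card {y // x ⬝ᵥ y = 0 ∧ π (z ⬝ᵥ y) = 0} = Nat.card {y // f y = 0} := by
    refine (Nat.card_congr ?_).symm
    refine (Equiv.subtypeSubtypeEquivSubtypeInter
      (fun y => y ∈ perp (Submodule.span R {x})) (fun y => π (z ⬝ᵥ y) = 0)).trans ?_
    exact Equiv.subtypeEquivRight fun y => by rw [mem_perp_span_singleton]
  rw [h2]
  exact (Nat.eq_of_mul_eq_mul_right Nat.card_pos h1).symm

/-- Neighbours satisfy `x' = a x + 2z`, and distinctness forces `x` and `z` to be independent modulo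
`2`. For `y` orthogonal to `x`, the second condition becomes `z · y ≡ 0` modulo `2`, which leaves
`(q^3 - q^2) / (q^2 - q) = q` lines. -/
theorem card_joint_of_cross_eq_zero {M N : (PHG R).Point} {x x' : Fin 3 → R}
    (hx : π ∘ x ≠ 0) (hx' : π ∘ x' ≠ 0) (hM : M.1 = Submodule.span R {x})
    (hN : N.1 = Submodule.span R {x'}) (hMN : M ≠ N) (h : π ∘ (x ⨯₃ x') = 0) :
    Nat.card {L // (PHG R).incident M L ∧ (PHG R).incident N L} = Nat.card k := by
  obtain ⟨a, z, haz⟩ := hπ.exists_smul_of_map_cross_eq_zero hx h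
  have hz : π ∘ (x ⨯₃ z) ≠ 0 := by
    intro h0
    obtain ⟨b, w, hbw⟩ := hπ.exists_smul_of_map_cross_eq_zero hx h0
    apply hMN
    refine Subtype.ext ?_
    rw [hM, hN]
    refine (hπ.span_eq_of_eq_smul hx' (a := a + 2 * b) ?_).symm
    rw [haz, hbw]
    ext i
    simp only [Pi.add_apply, Pi.smul_apply, smul_eq_mul, two_smul]
    linear_combination w i * hπ.two_mul_two
  have key : ∀ y, x ⬝ᵥ y = 0 ∧ x' ⬝ᵥ y = 0 ↔ x ⬝ᵥ y = 0 ∧ π (z ⬝ᵥ y) = 0 := by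
    intro y
    refine and_congr_right fun hy => ?_
    rw [haz, add_dotProduct, smul_dotProduct, smul_dotProduct, hy, smul_zero, zero_add,
      nsmul_eq_mul, Nat.cast_ofNat, hπ.two_mul_eq_zero_iff, hπ.map_eq_zero_iff]
  have h1 := hπ.card_lines_mul (fun L => (PHG R).incident M L ∧ (PHG R).incident N L)
    (fun y => x ⬝ᵥ y = 0 ∧ x' ⬝ᵥ y = 0)
    fun y => and_congr (PHG.incident_iff hM rfl) (PHG.incident_iff hN rfl)
  have h3 : Nat.card {y // π ∘ y = 0 ∧ x ⬝ᵥ y = 0 ∧ x' ⬝ᵥ y = 0} = Nat.card k ^ 2 := by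
    rw [← hπ.card_map_eq_zero_dotProduct hx]
    refine Nat.card_congr (Equiv.subtypeEquivRight fun y => and_congr_right fun hy => ?_)
    rw [key, RingHom.map_dotProduct, hy, dotProduct_zero]
    simp
  rw [h3, Nat.card_congr (Equiv.subtypeEquivRight key), hπ.card_joint_solutions hx hz] at h1
  have h2 := hπ.card_map_ne_zero_add
  refine Nat.eq_of_mul_eq_mul_right π.card_map_ne_zero_pos ?_
  generalize Nat.card {a // π a ≠ 0} = u at *
  generalize Nat.card k = q at *
  zify at *
  linear_combination h1 - q * h2

/-- A common normal `y` satisfies `(x × x') × y = 0`, so it is a multiple of the unimodular vector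
`x × x'`. -/
theorem card_joint_of_cross_ne_zero {M N : (PHG R).Point} {x x' : Fin 3 → R}
    (hM : M.1 = Submodule.span R {x}) (hN : N.1 = Submodule.span R {x'})
    (h : π ∘ (x ⨯₃ x') ≠ 0) :
    Nat.card {L // (PHG R).incident M L ∧ (PHG R).incident N L} = 1 := by
  have h1 : ∀ L, (PHG R).incident M L ∧ (PHG R).incident N L ↔ L = hπ.line ⟨_, h⟩ := by
    intro L
    constructor
    · rintro ⟨hML, hNL⟩
      obtain ⟨y, hy, hL⟩ := hπ.exists_eq_perp_span L.2
      rw [PHG.incident_iff hM hL] at hML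
      rw [PHG.incident_iff hN hL] at hNL
      obtain ⟨w, hw⟩ := hπ.exists_dotProduct_eq_one h
      obtain ⟨a, ha⟩ := exists_smul_of_cross_eq_zero hw (y := y) (by
        rw [cross_cross_eq_smul_sub_smul, hML, hNL, zero_smul, zero_smul, sub_zero])
      refine Subtype.ext ?_
      rw [hL, hπ.span_eq_of_eq_smul hy ha]
      rfl
    · rintro rfl
      rw [PHG.incident_iff hM rfl, PHG.incident_iff hN rfl]
      exact ⟨dot_self_cross x x', dot_cross_self x x'⟩
  rw [Nat.card_congr (Equiv.subtypeEquivRight h1)]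
  exact Nat.card_unique

/-- The neighbour class of a point, as a point of the projective plane over the residue field. -/
noncomputable def neighbourClass (N : (PHG R).Point) : ℙ k (Fin 3 → k) :=
  Projectivization.mk k (π ∘ (hπ.exists_eq_span N.2).choose)
    (hπ.exists_eq_span N.2).choose_spec.1

theorem neighbourClass_eq {N : (PHG R).Point} {x : Fin 3 → R} (hx : π ∘ x ≠ 0)
    (hN : N.1 = Submodule.span R {x}) :
    hπ.neighbourClass N = Projectivization.mk k (π ∘ x) hx := by
  have h := (hπ.exists_eq_span N.2).choose_spec
  rw [neighbourClass, Projectivization.mk_eq_mk_iff']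
  have h1 : (hπ.exists_eq_span N.2).choose ∈ Submodule.span R {x} :=
    hN.le (h.2.ge (Submodule.mem_span_singleton_self _))
  obtain ⟨a, ha⟩ := Submodule.mem_span_singleton.1 h1
  refine ⟨π a, ?_⟩
  rw [← ha]
  ext i
  simp

theorem hasHjelmslevCounts :
    (PHG R).HasHjelmslevCounts (Nat.card k) hπ.neighbourClass where
  card_class := by
    have := hπ.finite_residue
    rw [Projectivization.card_of_finrank k (Fin 3 → k) (n := 3) (by simp)]
    simp [Finset.sum_range_succ]
    ring
  card_line := hπ.card_lines
  card_pencil := hπ.card_pencil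
  card_joint_of_eq M N hMN h := by
    obtain ⟨x, hx, hM⟩ := hπ.exists_eq_span M.2
    obtain ⟨x', hx', hN⟩ := hπ.exists_eq_span N.2
    rw [hπ.neighbourClass_eq hx hM, hπ.neighbourClass_eq hx' hN, Projectivization.mk_eq_mk_iff_cross,
      ← map_cross] at h
    exact hπ.card_joint_of_cross_eq_zero hx hx' hM hN hMN h
  card_joint_of_ne M N h := by
    obtain ⟨x, hx, hM⟩ := hπ.exists_eq_span M.2
    obtain ⟨x', hx', hN⟩ := hπ.exists_eq_span N.2
    rw [hπ.neighbourClass_eq hx hM, hπ.neighbourClass_eq hx' hN, ne_eq, Projectivization.mk_eq_mk_iff_cross,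
      ← map_cross] at h
    exact hπ.card_joint_of_cross_ne_zero hM hN h

end IsReductionModTwo

/-! ### Hyperovals from squares in a cubic extension -/

/-- Expansion of a vector in terms of three vectors in `R ^ 3`. -/
theorem triple_product_smul_eq {R : Type} [CommRing R] (u v w x : Fin 3 → R) :
    (w ⬝ᵥ u ⨯₃ v) • x = (w ⬝ᵥ x ⨯₃ v) • u + (w ⬝ᵥ u ⨯₃ x) • v + (x ⬝ᵥ u ⨯₃ v) • w := by
  ext i
  simp only [cross_apply, Matrix.vec3_dotProduct, Pi.add_apply, Pi.smul_apply, smul_eq_mul,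
    Matrix.cons_val]
  fin_cases i <;> dsimp <;> ring

/-- In a cubic extension, quadratic relations over the base field are trivial. -/
theorem mem_range_of_quadratic_of_finrank_eq_three {k K : Type} [Field k] [Field K] [Algebra k K]
    (h3 : Module.finrank k K = 3) {a b c : k} (hb : b ≠ 0) {t : K}
    (ht : algebraMap k K a * t ^ 2 + algebraMap k K b * t + algebraMap k K c = 0) :
    ∃ s : k, algebraMap k K s = t := by
  have : FiniteDimensional k K := FiniteDimensional.of_finrank_pos (by lia)
  let p : k[X] := C a * X ^ 2 + C b * X + C c
  have hp : p ≠ 0 := fun h => hb (by simpa [p, coeff_X, coeff_C] using congrArg (coeff · 1) h)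
  have h1 : natDegree (minpoly k t) ≤ 2 :=
    (natDegree_le_natDegree (minpoly.degree_le_of_ne_zero k t hp (by simpa [p] using ht))).trans
      natDegree_quadratic_le
  -- The degree divides `3` and is at most `2`, so it is `1`.
  have h2 : natDegree (minpoly k t) ∣ 3 := h3 ▸ minpoly.degree_dvd (Algebra.IsIntegral.isIntegral t)
  have h4 : natDegree (minpoly k t) = 1 := by
    rcases (Nat.dvd_prime Nat.prime_three).1 h2 with h | h <;> lia
  exact minpoly.natDegree_eq_one_iff.1 h4

namespace IsReductionModTwo

variable {R k S K : Type} [CommRing R] [Field k] [CommRing S] [Field K] [Algebra R S] [Algebra k K]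
  {π : R →+* k} (hπ : IsReductionModTwo π) {ρ : S →+* K} (hρ : IsReductionModTwo ρ)

theorem charP (hπ : IsReductionModTwo π) : CharP k 2 :=
  CharTwo.of_one_ne_zero_of_two_eq_zero one_ne_zero hπ.map_two

theorem exists_sq_eq (hπ : IsReductionModTwo π) [Finite k] (a : k) : ∃ b, b ^ 2 = a := by
  have := hπ.charP
  obtain ⟨b, hb⟩ := FiniteField.isSquare_of_char_two (ringChar.eq k 2) a
  exact ⟨b, by rw [hb, sq]⟩

include hπ hρ

/-- The squares of three elements with pairwise different residue classes up to scalars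
are linearly independent. -/
theorem sq_ne_smul_add_smul [Finite k]
    (hcomp : ∀ a, ρ (algebraMap R S a) = algebraMap k K (π a)) (h3 : Module.finrank k K = 3)
    {x y z : S} (hxy : ∀ c : k, ρ x ^ 2 ≠ c • ρ y ^ 2) (hzx : ∀ c : k, ρ z ^ 2 ≠ c • ρ x ^ 2)
    (hzy : ∀ c : k, ρ z ^ 2 ≠ c • ρ y ^ 2) (a b : R) : z ^ 2 ≠ a • x ^ 2 + b • y ^ 2 := by
  intro hz
  -- Every element of the finite field `k` of characteristic `2` is a square.
  have hroot : ∀ a : R, ∃ c d : R, a = c ^ 2 + 2 * d := by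
    intro a
    obtain ⟨c, hc⟩ := hπ.exists_sq_eq (π a)
    obtain ⟨c, rfl⟩ := hπ.surjective c
    obtain ⟨d, hd⟩ := hπ.exists_eq_add_two_mul (x := a) (y := c ^ 2) (by rw [map_pow, hc])
    exact ⟨c, d, hd⟩
  obtain ⟨α, a', ha⟩ := hroot a
  obtain ⟨β, b', hb⟩ := hroot b
  have hπ2 := (hπ.map_eq_zero_iff 2).2 dvd_rfl
  have hK2 := hρ.map_two
  simp only [Algebra.smul_def] at hz hxy hzx hzy
  have h1 : ρ z ^ 2 = (algebraMap k K (π α) * ρ x + algebraMap k K (π β) * ρ y) ^ 2 := by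
    have := congrArg ρ hz
    simp only [map_add, map_mul, map_pow, hcomp, ha, hb, hπ2, zero_mul, add_zero, map_zero] at this
    linear_combination this -
      (algebraMap k K (π α) * ρ x * algebraMap k K (π β) * ρ y) * hK2
  have hy0 : ρ y ≠ 0 := by
    intro h
    refine hzx (π α ^ 2) ?_
    rw [h1, h, map_pow]
    ring
  -- Squaring is injective in characteristic `2`. Hence `z^2 = (αx + βy)^2` holds exactly in `S`,
  -- and comparison with `z^2 = a x^2 + b y^2` leaves only terms divisible by `2`.
  have h2 : ρ z = ρ (algebraMap R S α * x + algebraMap R S β * y) := by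
    rw [map_add, map_mul, map_mul, hcomp, hcomp]
    have h0 : (ρ z - (algebraMap k K (π α) * ρ x + algebraMap k K (π β) * ρ y)) ^ 2 = 0 := by
      linear_combination h1 + (algebraMap k K (π α) * ρ x + algebraMap k K (π β) * ρ y) *
        (algebraMap k K (π α) * ρ x + algebraMap k K (π β) * ρ y - ρ z) * hK2
    exact sub_eq_zero.1 (pow_eq_zero_iff two_ne_zero |>.1 h0)
  have h4 := hρ.sq_eq_sq h2
  have h5 : 2 * (algebraMap R S α * algebraMap R S β * (x * y)) =
      2 * (algebraMap R S a' * x ^ 2 + algebraMap R S b' * y ^ 2) := by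
    rw [h4, ha, hb] at hz
    simp only [map_add, map_mul, map_pow, map_ofNat] at hz
    linear_combination hz
  rw [hρ.two_mul_eq_iff] at h5
  simp only [map_add, map_mul, map_pow, hcomp] at h5
  have hα : π α ≠ 0 := by
    intro h
    refine hzy (π β ^ 2) ?_
    rw [h1, h, map_zero, map_pow]
    ring
  have hβ : π β ≠ 0 := by
    intro h
    refine hzx (π α ^ 2) ?_
    rw [h1, h, map_zero, map_pow]
    ring
  -- Modulo `2` the comparison says that `x / y` is a root of `a' T^2 - αβ T + b'`, where `αβ ≠ 0`.
  -- Then `x / y` lies in `k`, against `hxy`.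
  obtain ⟨s, hs⟩ := mem_range_of_quadratic_of_finrank_eq_three h3 (a := π a')
    (b := - (π α * π β)) (c := π b') (neg_ne_zero.2 (mul_ne_zero hα hβ)) (t := ρ x / ρ y) (by
      field_simp
      rw [map_neg, map_mul]
      linear_combination -h5)
  refine hxy (s ^ 2) ?_
  rw [map_pow, hs]
  field_simp

/-- Independence modulo `2` is used twice: it first makes `a` and `b` divisible by `2`, then, after
cancelling that `2`, makes the quotients divisible by `2` as well. -/
theorem eq_zero_of_smul_sq_add_smul_sq
    (hcomp : ∀ a, ρ (algebraMap R S a) = algebraMap k K (π a)) {x y : S}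
    (hxy : ∀ c : k, ρ x ^ 2 ≠ c • ρ y ^ 2) (hyx : ∀ c : k, ρ y ^ 2 ≠ c • ρ x ^ 2)
    {a b : R} (h : a • x ^ 2 + b • y ^ 2 = 0) : a = 0 ∧ b = 0 := by
  have key : ∀ a b : R, ρ (a • x ^ 2 + b • y ^ 2) = 0 → 2 ∣ a ∧ 2 ∣ b := by
    intro a b h
    simp only [Algebra.smul_def, map_add, map_mul, map_pow, hcomp] at h hxy hyx
    rw [← hπ.map_eq_zero_iff, ← hπ.map_eq_zero_iff]
    constructor
    · by_contra ha
      refine hxy (-((π a)⁻¹ * π b)) ?_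
      have : algebraMap k K (π a) ≠ 0 := by simpa using ha
      rw [map_neg, map_mul, map_inv₀]
      field_simp
      linear_combination h
    · by_contra hb
      refine hyx (-((π b)⁻¹ * π a)) ?_
      have : algebraMap k K (π b) ≠ 0 := by simpa using hb
      rw [map_neg, map_mul, map_inv₀]
      field_simp
      linear_combination h
  obtain ⟨⟨a, rfl⟩, ⟨b, rfl⟩⟩ := key a b (by rw [h, map_zero])
  have h1 : 2 * (a • x ^ 2 + b • y ^ 2) = 0 := by
    simp only [Algebra.smul_def, map_mul, map_ofNat] at h ⊢
    linear_combination h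
  rw [hρ.two_mul_eq_zero_iff, ← hρ.map_eq_zero_iff] at h1
  rw [hπ.two_mul_eq_zero_iff, hπ.two_mul_eq_zero_iff]
  exact key a b h1

variable [Finite R]

open IncidenceStructure in
/-- Hyperovals from squares in a cubic extension. -/
theorem exists_isHyperoval_of_cubic [Finite K]
    (hcomp : ∀ a, ρ (algebraMap R S a) = algebraMap k K (π a)) (h3 : Module.finrank k K = 3)
    (e : S ≃ₗ[R] (Fin 3 → R)) : ∃ H : (PHG R).Point → ℕ, IsHyperoval (Nat.card k) H := by
  classical
  have := hπ.finite_residue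
  -- The lift of a representative of `P` is chosen to be a square.
  have hs : ∀ P : ℙ k K, ∃ s : S, ρ s ^ 2 = P.rep := by
    intro P
    obtain ⟨b, hb⟩ := hρ.exists_sq_eq P.rep
    obtain ⟨s, rfl⟩ := hρ.surjective b
    exact ⟨s, hb⟩
  choose s hs using hs
  have hne : ∀ P Q, P ≠ Q → ∀ c : k, ρ (s P) ^ 2 ≠ c • ρ (s Q) ^ 2 := by
    intro P Q hPQ c h
    apply hPQ
    rw [hs, hs] at h
    rw [← P.mk_rep, ← Q.mk_rep, Projectivization.mk_eq_mk_iff']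
    exact ⟨c, h.symm⟩
  have huni : ∀ P, π ∘ e (s P ^ 2) ≠ 0 := by
    intro P h
    obtain ⟨z, hz⟩ := hπ.exists_eq_two_smul h
    have h1 : s P ^ 2 = 2 * e.symm z := by
      rw [e.eq_symm_apply.2 hz, map_smul, Algebra.smul_def, map_ofNat]
    refine P.rep_nonzero ?_
    rw [← hs, ← map_pow, hρ.map_eq_zero_iff]
    exact ⟨_, h1⟩
  let f : ℙ k K → (PHG R).Point := fun P => hπ.point ⟨_, huni P⟩
  have hf : Function.Injective f := by
    intro P Q hPQ
    by_contra hne'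
    have h1 : e (s P ^ 2) ∈ Submodule.span R {e (s Q ^ 2)} :=
      (congrArg Subtype.val hPQ).le (Submodule.mem_span_singleton_self _)
    obtain ⟨a, ha⟩ := Submodule.mem_span_singleton.1 h1
    rw [← map_smul] at ha
    have h2 := congrArg ρ (e.injective ha)
    rw [Algebra.smul_def, map_mul, map_pow, map_pow, hcomp] at h2
    refine hne P Q hne' (π a) ?_
    rw [Algebra.smul_def, h2]
  have hline : ∀ P Q T, P ≠ Q → T ≠ P → T ≠ Q → ∀ L, (PHG R).incident (f P) L →
      (PHG R).incident (f Q) L → ¬ (PHG R).incident (f T) L := by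
    intro P Q T hPQ hTP hTQ L hP hQ hT
    obtain ⟨y, hy, hL⟩ := hπ.exists_eq_perp_span L.2
    rw [PHG.incident_iff rfl hL] at hP hQ hT
    have hc : π ∘ (e (s P ^ 2) ⨯₃ e (s Q ^ 2)) ≠ 0 := by
      refine hπ.map_cross_ne_zero fun a b hab => ?_
      refine hπ.eq_zero_of_smul_sq_add_smul_sq hρ hcomp (hne P Q hPQ) (hne Q P hPQ.symm)
        (e.injective ?_)
      rw [map_add, map_smul, map_smul, hab, map_zero]
    obtain ⟨w, hw⟩ := hπ.exists_dotProduct_eq_one hc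
    obtain ⟨a, ha⟩ := exists_smul_of_cross_eq_zero hw (y := y) (by
      rw [cross_cross_eq_smul_sub_smul, hP, hQ, zero_smul, zero_smul, sub_zero])
    have hau : IsUnit a := hπ.isUnit_iff.2 fun h0 => hy (by
      ext i
      rw [ha]
      simp [h0])
    -- The normal of `L` is a unit multiple of the cross product for `P` and `Q`, so the triple
    -- product vanishes. The expansion `h1` then writes the square for `T` as a combination of the
    -- other two.
    rw [ha, dotProduct_smul, smul_eq_mul, hau.mul_right_eq_zero] at hT
    have h1 := triple_product_smul_eq (e (s P ^ 2)) (e (s Q ^ 2)) w (e (s T ^ 2))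
    rw [dotProduct_comm, hw, one_smul, hT, zero_smul, add_zero, ← map_smul, ← map_smul,
      ← map_add] at h1
    exact hπ.sq_ne_smul_add_smul hρ hcomp h3 (hne P Q hPQ) (hne T P hTP) (hne T Q hTQ) _ _
      (e.injective h1)
  have := PHG.finite_point R
  have := Fintype.ofFinite (PHG R).Point
  have := Fintype.ofFinite (ℙ k K)
  refine ⟨fun N => if N ∈ Finset.univ.image f then 1 else 0, ?_, fun L => ?_⟩
  · rw [size_eq_sum, ← Finset.card_filter, Finset.filter_mem_eq_inter, Finset.univ_inter,
      Finset.card_image_of_injective _ hf, Finset.card_univ, ← Nat.card_eq_fintype_card,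
      Projectivization.card_of_finrank k K h3]
    simp [Finset.sum_range_succ]
    ring
  · rw [lineMult_eq_sum, ← Finset.sum_filter, ← Finset.card_filter]
    by_contra! h
    obtain ⟨N₁, h1, N₂, h2, N₃, h3, h12, h13, h23⟩ := Finset.two_lt_card.1 h
    simp only [Finset.mem_filter, Finset.mem_univ, true_and, Finset.mem_image] at h1 h2 h3
    obtain ⟨hL1, P, rfl⟩ := h1
    obtain ⟨hL2, Q, rfl⟩ := h2
    obtain ⟨hL3, T, rfl⟩ := h3
    exact hline P Q T (fun h => h12 (h ▸ rfl)) (fun h => h13 (h ▸ rfl)) (fun h => h23 (h ▸ rfl))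
      L hL1 hL2 hL3

omit [CommRing S] [Field K] [Algebra R S] [Algebra k K] hρ

open IncidenceStructure in
theorem exists_isHyperoval : ∃ H : (PHG R).Point → ℕ, IsHyperoval (Nat.card k) H := by
  have := hπ.finite_residue
  have := hπ.nontrivial
  have := hπ.charP
  have := ZMod.algebra k 2
  obtain ⟨t, ht⟩ := Field.exists_primitive_element k (FiniteField.Extension k 2 3)
  rw [Field.primitive_element_iff_minpoly_natDegree_eq, FiniteField.finrank_extension] at ht
  have hint : IsIntegral k t := Algebra.IsIntegral.isIntegral t
  have hlift : minpoly k t ∈ lifts π := by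
    rw [mem_lifts]
    exact Polynomial.map_surjective π hπ.surjective _
  -- The cubic extension of `R` is `R[X] / (g)`, with `g` a monic lift of the minimal polynomial of
  -- a primitive element of the cubic extension of `k`.
  obtain ⟨g, hg, hgdeg, hgmon⟩ := lifts_and_natDegree_eq_and_monic hlift (minpoly.monic hint)
  have : Fact (Irreducible (g.map π)) := ⟨hg ▸ minpoly.irreducible hint⟩
  have hdeg : (g.map π).natDegree = 3 := by rw [hg, ht]
  have hgdeg' : g.natDegree = 3 := by rw [hgdeg, ht]
  have := (hgmon.map π).finite_adjoinRoot
  have : Finite (AdjoinRoot (g.map π)) := Module.finite_of_finite k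
  refine hπ.exists_isHyperoval_of_cubic (hπ.adjoinRoot hgmon) (fun a => ?_) ?_
    ((AdjoinRoot.powerBasis' hgmon).basis.equivFun.trans
      (LinearEquiv.funCongrLeft R R (finCongr hgdeg').symm))
  · exact AdjoinRoot.map_of _ _ _ _ _
  · rw [(AdjoinRoot.powerBasis' (hgmon.map π)).finrank, AdjoinRoot.powerBasis'_dim, hdeg]

end IsReductionModTwo

/-! ### The Galois ring and the main theorem -/

/-- The residue field of the Galois ring. -/
theorem IsGaloisPoly.exists_isReductionModTwo {r : ℕ} {h : (ZMod (2 ^ 2))[X]}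
    (hh : IsGaloisPoly 2 r h) : ∃ (k : Type) (_ : Field k) (π : GaloisRing 2 h →+* k),
      IsReductionModTwo π ∧ Nat.card k = 2 ^ r := by
  have : Fact (Irreducible (h.map (ZMod.castHom (dvd_pow_self 2 two_ne_zero) (ZMod 2)))) :=
    ⟨hh.irreducible⟩
  have hmon := hh.monic.map (ZMod.castHom (dvd_pow_self 2 two_ne_zero) (ZMod 2))
  refine ⟨AdjoinRoot (h.map (ZMod.castHom (dvd_pow_self 2 two_ne_zero) (ZMod 2))), inferInstance,
    _, isReductionModTwo_zmod.adjoinRoot hh.monic, ?_⟩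
  have := hmon.finite_adjoinRoot
  have := hmon.free_adjoinRoot
  rw [Module.natCard_eq_pow_finrank_of_free (R := ZMod 2) rfl, Nat.card_zmod,
    (AdjoinRoot.powerBasis' hmon).finrank, AdjoinRoot.powerBasis'_dim, hh.monic.natDegree_map,
    hh.natDegree_eq]

theorem mainTheorem4 (r q : ℕ) (hq : q = 2 ^ r) (h : (ZMod (2 ^ 2))[X])
    (hh : IsGaloisPoly 2 r h) :
    (∃ H : (PHG (GaloisRing 2 h)).Point → ℕ, IsHyperoval q H) ∧
    Nonempty (IncidenceStructure.Iso (PHG (GaloisRing 2 h)).dual (PHG (GaloisRing 2 h))) ∧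
    (∀ H : (PHG (GaloisRing 2 h)).Point → ℕ, IsHyperoval q H →
      ∀ σ : IncidenceStructure.Iso (PHG (GaloisRing 2 h)).dual (PHG (GaloisRing 2 h)),
        IncidenceStructure.IsProjective (σ.mapMultiset (IncidenceStructure.passants H)) ∧
        IncidenceStructure.IsArc (σ.mapMultiset (IncidenceStructure.passants H))
          ((q ^ 4 - q) / 2) (q ^ 2 / 2) ∧
        (∀ L : (PHG (GaloisRing 2 h)).Line,
          IncidenceStructure.lineMult (σ.mapMultiset (IncidenceStructure.passants H)) L = 0 ∨
          IncidenceStructure.lineMult (σ.mapMultiset (IncidenceStructure.passants H)) L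
            = q ^ 2 / 2) ∧
        IncidenceStructure.IsMaximalArc (σ.mapMultiset (IncidenceStructure.passants H))
          ((q ^ 4 - q) / 2) (q ^ 2 / 2)) ∧
    (PHG (GaloisRing 2 h)).maxArcSize (q ^ 2 / 2) = (q ^ 4 - q) / 2 := by
  have := hh.finite
  obtain ⟨k, _, π, hπ, hk⟩ := hh.exists_isReductionModTwo
  rw [← hk] at hq
  subst hq
  have := hπ.finite_residue
  have := PHG.finite_point (GaloisRing 2 h)
  have hS := hπ.hasHjelmslevCounts
  have h2 : 2 ≤ Nat.card k := Finite.one_lt_card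
  -- `r ≠ 0` follows because the field `k` has `2 ^ r` elements and at least two of them.
  have hdvd : 2 ∣ Nat.card k := hk ▸ dvd_pow_self 2 (fun hr => by
    rw [hk, hr] at h2
    lia)
  obtain ⟨H, hH⟩ := hπ.exists_isHyperoval
  have hmain := hS.passants_map h2 hdvd hH hπ.dualIso
  exact ⟨⟨H, hH⟩, ⟨hπ.dualIso⟩, fun H hH σ => hS.passants_map h2 hdvd hH σ,
    IncidenceStructure.maxArcSize_eq hmain.1 hmain.2.2.2⟩
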